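/- Theorem 2.10. Every locally finite quasivariety of MV-algebras is finitely axiomatizable. Here an MV-algebra is an algebra $\mathbf{A}=\langle A,\oplus,\neg,0\rangle$ of type $(2,1,0)$ that satisfies $(x\oplus y)\oplus z\approx x\oplus(y\oplus z)$, $x\oplus y\approx y\oplus x$, $x\oplus 0\approx x$, $\neg\neg x\approx x$, $x\oplus\neg 0\approx\neg 0$ and $\neg(\neg x\oplus y)\oplus y\approx\neg(x\oplus\neg y)\oplus x$. A class of algebras is a quasivariety if it is closed under isomorphic images, subalgebras and reduced products (the empty product, i.e. the one-element algebra, included). A class $\mathbb{K}$ of algebras is locally finite if every finitely generated subalgebra of every member of $\mathbb{K}$ is finite. Explicitly: let $\mathbb{K}$ be a locally finite quasivariety all of whose members are MV-algebras. Then there is a finite set $\Sigma$ of quasiequations $$\varphi_1\approx\psi_1\ \&\ \cdots\ \&\ \varphi_m\approx\psi_m\ \Rightarrow\ \varphi\approx\psi\qquad(m\ge 0)$$ between terms in the operations $\oplus,\neg,0$ such that, for every algebra $\mathbf{A}$ of type $(2,1,0)$, $\mathbf{A}\in\mathbb{K}$ if and only if $\mathbf{A}$ satisfies every quasiequation in $\Sigma$.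 -/

import Mathlib

open FirstOrder FirstOrder.Language CategoryTheory

universe u v w

namespace UniversalAlgebra

variable {L : FirstOrder.Language.{v, w}}

/-- Coordinatewise interpretation of the symbols on `∀ i, M i`, which is compatible with the
relation "equal on a set of indices belonging to the filter `F`". -/
@[reducible] def reducedPrestructure {I : Type u} (F : Filter I) (M : I → Type u) [∀ i, L.Structure (M i)] :
    L.Prestructure (F.productSetoid M) where
  toStructure :=
    { funMap := fun f x i => Structure.funMap f fun k => x k i
      RelMap := fun r x => ∀ᶠ i in F, Structure.RelMap r fun k => x k i }
  fun_equiv := fun {n} f x y (xy : ∀ k, ∀ᶠ i in F, x k i = y k i) => by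
    change ∀ᶠ i in F, Structure.funMap f (fun k => x k i) = Structure.funMap f (fun k => y k i)
    filter_upwards [Filter.eventually_all.2 xy] with i hi
    rw [funext hi]
  rel_equiv := fun {n} r x y (xy : ∀ k, ∀ᶠ i in F, x k i = y k i) => by
    refine propext (Filter.eventually_congr ?_)
    filter_upwards [Filter.eventually_all.2 xy] with i hi
    rw [funext hi]

/-- The reduced product of the family `M` modulo the filter `F`: the quotient of the direct product
by "equal on a set of indices belonging to `F`". All filters are allowed, so that direct products
(`F = ⊤`), ultraproducts, and the one-element empty product are included. -/
def reducedProduct {I : Type u} (F : Filter I) (M : I → Bundled.{u} L.Structure) :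
    Bundled.{u} L.Structure :=
  ⟨F.Product fun i => M i,
    letI := reducedPrestructure (L := L) F fun i => (M i : Type u)
    inferInstanceAs (L.Structure (Quotient (F.productSetoid fun i => (M i : Type u))))⟩

/-- A class of algebras is a quasivariety if it is closed under isomorphic images, subalgebras
and reduced products. -/
structure IsQuasivariety (K : Set (Bundled.{u} L.Structure)) : Prop where
  iso : ∀ A ∈ K, ∀ B : Bundled.{u} L.Structure, Nonempty (A ≃[L] B) → B ∈ K
  sub : ∀ A ∈ K, ∀ S : L.Substructure A, (⟨S, inferInstance⟩ : Bundled.{u} L.Structure) ∈ K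
  reduced : ∀ (I : Type u) (F : Filter I) (M : I → Bundled.{u} L.Structure),
    (∀ i, M i ∈ K) → reducedProduct F M ∈ K

/-- A class of algebras is locally finite if every finitely generated subalgebra of every member
is finite. -/
def IsLocallyFinite (K : Set (Bundled.{u} L.Structure)) : Prop :=
  ∀ A ∈ K, ∀ S : L.Substructure A, S.FG → Finite S

variable (L) in
/-- A quasiequation `φ₁ ≈ ψ₁ & … & φₘ ≈ ψₘ ⇒ φ ≈ ψ` (`m ≥ 0`) between terms in the variables
`x₀, x₁, …`. -/
structure Quasiequation where
  premises : List (L.Term ℕ × L.Term ℕ)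
  conclusion : L.Term ℕ × L.Term ℕ

/-- Validity of a quasiequation in an algebra. -/
def Quasiequation.Holds (q : Quasiequation L) (A : Type u) [L.Structure A] : Prop :=
  ∀ x : ℕ → A, (∀ e ∈ q.premises, e.1.realize x = e.2.realize x) →
    q.conclusion.1.realize x = q.conclusion.2.realize x

/-- `K` is the class of all algebras of the given type that satisfy some finite set of
quasiequations. -/
def IsFinitelyAxiomatizable (K : Set (Bundled.{u} L.Structure)) : Prop :=
  ∃ Q : Set (Quasiequation L), Q.Finite ∧
    ∀ A : Bundled.{u} L.Structure, A ∈ K ↔ ∀ q ∈ Q, q.Holds A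

end UniversalAlgebra

namespace MV

/-- The operation symbols `⊕`, `¬`, `0` of arities `2`, `1`, `0`. -/
inductive Func : ℕ → Type
  | oplus : Func 2
  | neg : Func 1
  | zero : Func 0

/-- The algebraic type `(2, 1, 0)` of MV-algebras. -/
def lang : FirstOrder.Language.{0, 0} := ⟨Func, fun _ => Empty⟩

section

variable {A : Type u} [lang.Structure A]

def oplus (x y : A) : A := Structure.funMap (L := lang) Func.oplus ![x, y]

def neg (x : A) : A := Structure.funMap (L := lang) Func.neg ![x]

variable (A) in
def zero : A := Structure.funMap (L := lang) Func.zero ![]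

end

structure IsMVAlgebra (A : Type u) [lang.Structure A] : Prop where
  assoc : ∀ x y z : A, oplus (oplus x y) z = oplus x (oplus y z)
  comm : ∀ x y : A, oplus x y = oplus y x
  oplus_zero : ∀ x : A, oplus x (zero A) = x
  neg_neg : ∀ x : A, neg (neg x) = x
  oplus_neg_zero : ∀ x : A, oplus x (neg (zero A)) = neg (zero A)
  lukasiewicz : ∀ x y : A,
    oplus (neg (oplus (neg x) y)) y = oplus (neg (oplus x (neg y))) x

end MV

/-! Local finiteness bounds the members of `K` uniformly: in a product of counterexamples to `n x ≈
(n + 1) x`, one for each `n`, a single element would have infinitely many multiples. So some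
equation `n x ≈ (n + 1) x` holds throughout `K` (`exists_nsmul_eq`).

In any MV-algebra satisfying it, `n x` is idempotent. Modulo an ultrafilter of idempotents every
nonzero element therefore has `n`-th multiple `1`, which makes the quotient a chain with at most `n
+ 1` elements (`quot_nsmul`, `finite_of_nsmul`). These quotients separate points and take finitely
many shapes, so finitely generated algebras are finite (`finite_of_fg`). A large finite algebra has
two coordinates of the same shape. Overwriting either one with the other gives two non-injective
endomorphisms that jointly separate points (`exists_separating_endomorphisms`), so the algebra
embeds in a product of powers of proper subalgebras.

Hence an algebra outside `K` all of whose proper subalgebras lie in `K` has bounded size. Up to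
isomorphism only finitely many small algebras lie outside `K`, and each is excluded by one
quasiequation read off its operation tables. These, together with the MV-axioms and `n x ≈ (n + 1)
x`, axiomatize `K` (`IsQuasivariety.isFinitelyAxiomatizable`). -/

namespace MV

/-- MV-algebras, with `x ⊕ y` written `x + y` and `¬x` written `xᶜ`. -/
class MVAlgebra (A : Type u) extends AddCommMonoid A, Compl A where
  compl_compl' : ∀ x : A, xᶜᶜ = x
  add_compl_zero : ∀ x : A, x + 0ᶜ = 0ᶜ
  lukasiewicz : ∀ x y : A, (xᶜ + y)ᶜ + y = (x + yᶜ)ᶜ + x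

namespace MVAlgebra

/-! ### Order, residuation and distributivity in MV-algebras. -/

section Arithmetic

variable {A : Type u} [MVAlgebra A]

lemma cc (x : A) : xᶜᶜ = x := compl_compl' x

lemma compl_add_self (x : A) : xᶜ + x = 0ᶜ := by
  have h := lukasiewicz (0ᶜ : A) x
  rw [cc, zero_add, add_comm (0ᶜ) (xᶜ), add_compl_zero] at h
  simpa only [cc, zero_add] using h

instance : PartialOrder A where
  le x y := xᶜ + y = 0ᶜ
  le_refl := compl_add_self
  le_trans x y z hxy hyz := by
    have h := lukasiewicz y z
    rw [hyz, cc, zero_add] at h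
    calc xᶜ + z = (xᶜ + y) + (y + zᶜ)ᶜ := by
          rw [add_assoc, add_comm y, ← h]
      _ = 0ᶜ := by rw [hxy, add_comm, add_compl_zero]
  le_antisymm x y hxy hyx := by
    have h := lukasiewicz x y
    rw [hxy, add_comm x, hyx, cc, zero_add, zero_add] at h
    exact h.symm

lemma le_def (x y : A) : x ≤ y ↔ xᶜ + y = 0ᶜ := Iff.rfl

/-- Truncated subtraction `x ⊖ y`. -/
def tsub (x y : A) : A := (xᶜ + y)ᶜ

/-- Residuation: truncated subtraction of `y` is left adjoint to adding `y`. Most order arguments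
below rest on it. -/
lemma tsub_le_iff (x y z : A) : tsub x y ≤ z ↔ x ≤ y + z := by
  rw [le_def, le_def, tsub, cc, add_assoc]

lemma zero_le' (x : A) : 0 ≤ x := by rw [le_def, add_comm, add_compl_zero]

lemma le_one (x : A) : x ≤ 0ᶜ := by rw [le_def, add_compl_zero]

lemma le_zero_iff' {x : A} : x ≤ 0 ↔ x = 0 :=
  ⟨fun h => le_antisymm h (zero_le' x), fun h => h.le⟩

lemma le_add_left' (x y : A) : x ≤ y + x := by
  rw [le_def, add_left_comm, compl_add_self, add_compl_zero]

lemma le_add_right' (x y : A) : x ≤ x + y := by rw [add_comm]; exact le_add_left' x y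

lemma add_mono_left {x y : A} (h : x ≤ y) (z : A) : z + x ≤ z + y := by
  rw [← tsub_le_iff]
  refine le_trans ?_ h
  rw [tsub_le_iff]

lemma add_mono {x y z t : A} (h : x ≤ y) (h' : z ≤ t) : x + z ≤ y + t := by
  refine (add_mono_left h' x).trans ?_
  rw [add_comm x, add_comm y]
  exact add_mono_left h t

lemma compl_anti {x y : A} (h : x ≤ y) : yᶜ ≤ xᶜ := by
  rw [le_def] at *; rw [cc, add_comm]; exact h

lemma compl_le_compl_iff' {x y : A} : yᶜ ≤ xᶜ ↔ x ≤ y :=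
  ⟨fun h => by simpa only [cc] using compl_anti h, compl_anti⟩

lemma tsub_add (x y : A) : tsub x y + y = tsub y x + x := by
  rw [tsub, tsub, lukasiewicz, add_comm x]

lemma tsub_eq_zero {x y : A} : tsub x y = 0 ↔ x ≤ y := by
  rw [← le_zero_iff', tsub_le_iff, add_zero]

lemma tsub_add_of_le {x y : A} (h : x ≤ y) : tsub y x + x = y := by
  rw [tsub_add, tsub_eq_zero.2 h, zero_add]

lemma isLUB_sup (x y : A) : x ≤ tsub x y + y ∧ y ≤ tsub x y + y ∧
    ∀ z, x ≤ z → y ≤ z → tsub x y + y ≤ z := by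
  refine ⟨by rw [tsub_add]; exact le_add_left' _ _, le_add_left' _ _, fun z hx hy => ?_⟩
  rw [← tsub_add_of_le hy]
  refine add_mono ?_ le_rfl
  rw [tsub_le_iff, add_comm, tsub_add_of_le hy]
  exact hx

instance : Lattice A where
  sup x y := tsub x y + y
  inf x y := (tsub xᶜ yᶜ + yᶜ)ᶜ
  le_sup_left x y := (isLUB_sup x y).1
  le_sup_right x y := (isLUB_sup x y).2.1
  sup_le x y z := (isLUB_sup x y).2.2 z
  inf_le_left x y := by
    have := compl_anti (isLUB_sup xᶜ yᶜ).1
    rwa [cc] at this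
  inf_le_right x y := by
    have := compl_anti (isLUB_sup xᶜ yᶜ).2.1
    rwa [cc] at this
  le_inf x y z h h' := by
    have := compl_anti ((isLUB_sup yᶜ zᶜ).2.2 _ (compl_anti h) (compl_anti h'))
    rwa [cc] at this

lemma sup_def (x y : A) : x ⊔ y = tsub x y + y := rfl

lemma compl_sup' (x y : A) : (x ⊔ y)ᶜ = xᶜ ⊓ yᶜ := by
  change _ = (tsub xᶜᶜ yᶜᶜ + yᶜᶜ)ᶜ
  rw [cc, cc, sup_def]

lemma compl_inf' (x y : A) : (x ⊓ y)ᶜ = xᶜ ⊔ yᶜ := by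
  rw [← cc (xᶜ ⊔ yᶜ), compl_sup', cc, cc]

lemma inf_eq_tsub (x y : A) : x ⊓ y = tsub x (tsub x y) := by
  rw [inf_comm]
  change (tsub yᶜ xᶜ + xᶜ)ᶜ = _
  simp only [tsub, cc]
  rw [add_comm y, add_comm]

lemma add_inf' (a x y : A) : a + x ⊓ y = (a + x) ⊓ (a + y) := by
  refine le_antisymm (le_inf (add_mono_left inf_le_left a) (add_mono_left inf_le_right a)) ?_
  rw [← tsub_le_iff]
  refine le_inf ?_ ?_ <;> rw [tsub_le_iff]
  exacts [inf_le_left, inf_le_right]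

lemma inf_add' (a x y : A) : x ⊓ y + a = (x + a) ⊓ (y + a) := by
  rw [add_comm, add_inf', add_comm a, add_comm a]

instance : DistribLattice A :=
  DistribLattice.ofInfSupLe fun x y z => by
    have hw : ∀ t, t ≤ y ⊔ z → tsub t x ≤ tsub (y ⊔ z) x := fun t ht => by
      rw [tsub_le_iff]
      refine ht.trans ?_
      rw [← tsub_le_iff]
    have key : ∀ t, t ≤ y ⊔ z → t ≤ tsub (y ⊔ z) x + x ⊓ t := fun t ht => by
      have h : t ≤ tsub t x + x ⊓ t := by
        rw [← tsub_le_iff, ← inf_eq_tsub, inf_comm]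
      exact h.trans (add_mono (hw t ht) le_rfl)
    -- With the meet written as a double difference, residuation leaves a bound on `y ⊔ z`, which
    -- can be checked on `y` and `z` separately.
    rw [inf_comm, inf_eq_tsub, tsub_le_iff]
    refine sup_le ((key y le_sup_left).trans ?_) ((key z le_sup_right).trans ?_)
    · exact add_mono_left le_sup_left _
    · exact add_mono_left le_sup_right _

lemma inf_zero' (x : A) : x ⊓ 0 = 0 := inf_eq_right.2 (zero_le' x)

lemma zero_inf' (x : A) : 0 ⊓ x = 0 := inf_eq_left.2 (zero_le' x)

lemma inf_one' (x : A) : x ⊓ 0ᶜ = x := inf_eq_left.2 (le_one x)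

lemma tsub_inf (x y : A) : tsub x (x ⊓ y) = tsub x y := by
  refine le_antisymm ?_ ?_
  · rw [tsub_le_iff, inf_add']
    refine le_inf (le_add_right' _ _) ?_
    rw [← tsub_le_iff]
  · rw [tsub_le_iff]
    refine (tsub_le_iff _ _ _).1 le_rfl |>.trans (add_mono inf_le_right le_rfl)

lemma tsub_inf_tsub (x y : A) : tsub x y ⊓ tsub y x = 0 := by
  set c := tsub x y ⊓ tsub y x with hc
  have h1 : x ⊓ y + tsub x y = x := by
    rw [← tsub_inf, add_comm, tsub_add_of_le inf_le_left]
  have h2 : x ⊓ y + tsub y x = y := by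
    rw [← tsub_inf y x, inf_comm y, add_comm, tsub_add_of_le inf_le_right]
  have h3 : x ⊓ y + c = x ⊓ y := by rw [hc, add_inf', h1, h2]
  have h4 : c ≤ (x ⊓ y)ᶜ := by
    refine inf_le_left.trans ?_
    rw [← tsub_inf, tsub_le_iff, add_comm, compl_add_self]
    exact le_one x
  have h5 := inf_eq_tsub (x ⊓ y)ᶜ c
  -- Cancellation: `c` lies below the complement of `x ⊓ y` and is absorbed when added to `x ⊓ y`,
  -- which forces `c = 0`.
  rw [inf_eq_right.2 h4, tsub, tsub, cc, h3, add_comm, compl_add_self, cc] at h5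
  exact h5

lemma inf_nsmul_eq_zero {a b : A} (h : a ⊓ b = 0) (k : ℕ) : a ⊓ k • b = 0 := by
  induction k with
  | zero => rw [zero_nsmul, inf_zero']
  | succ k ih =>
    rw [← le_zero_iff', ← ih]
    refine le_inf inf_le_left ?_
    calc a ⊓ (k + 1) • b ≤ (a + k • b) ⊓ (b + k • b) := by
          rw [succ_nsmul']; exact inf_le_inf (le_add_right' _ _) le_rfl
      _ = k • b := by rw [← inf_add', h, zero_add]

lemma nsmul_mono {a b : A} (h : a ≤ b) (k : ℕ) : k • a ≤ k • b := by
  induction k with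
  | zero => simp
  | succ k ih => rw [succ_nsmul, succ_nsmul]; exact add_mono ih h

lemma nsmul_le_nsmul' (a : A) {k l : ℕ} (h : k ≤ l) : k • a ≤ l • a := by
  obtain ⟨m, rfl⟩ := Nat.exists_eq_add_of_le h
  rw [add_nsmul]; exact le_add_right' _ _

lemma nsmul_stable {a : A} {n : ℕ} (h : n • a = (n + 1) • a) {m : ℕ} (hm : n ≤ m) :
    m • a = n • a := by
  induction m, hm using Nat.le_induction with
  | base => rfl
  | succ m _ ih => rw [succ_nsmul, ih, ← succ_nsmul, ← h]

lemma nsmul_idem {a : A} {n : ℕ} (h : n • a = (n + 1) • a) : n • a + n • a = n • a := by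
  rw [← add_nsmul]; exact nsmul_stable h (Nat.le_add_right _ _)

lemma exists_nsmul_stable {a : A} {s : Set A} (hs : s.Finite) (h : ∀ k : ℕ, k • a ∈ s) :
    ∃ k : ℕ, k • a = (k + 1) • a := by
  have := hs.to_subtype
  obtain ⟨k, l, hne, hkl⟩ := Finite.exists_ne_map_eq_of_infinite fun k : ℕ => (⟨k • a, h k⟩ : s)
  have hkl : k • a = l • a := congrArg Subtype.val hkl
  rcases hne.lt_or_gt with hlt | hlt
  · refine ⟨k, le_antisymm (nsmul_le_nsmul' a k.le_succ) ?_⟩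
    rw [hkl]; exact nsmul_le_nsmul' a hlt
  · refine ⟨l, le_antisymm (nsmul_le_nsmul' a l.le_succ) ?_⟩
    rw [← hkl]; exact nsmul_le_nsmul' a hlt

/-! ### Idempotents as direct decompositions. -/

section Idempotent

variable {e : A} (he : e + e = e)
include he

lemma sup_compl_of_idem : e ⊔ eᶜ = 0ᶜ := by
  rw [sup_comm, sup_def, tsub, cc, he, compl_add_self]

lemma inf_compl_of_idem : e ⊓ eᶜ = 0 := by
  rw [← cc (e ⊓ eᶜ), compl_inf', cc, sup_comm, sup_compl_of_idem he, cc]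

lemma compl_idem : eᶜ + eᶜ = eᶜ := by
  have h := add_inf' eᶜ e eᶜ
  rw [inf_compl_of_idem he, add_zero, compl_add_self, inf_comm, inf_one'] at h
  exact h.symm

/-- Together with `compl_inf_inf_idem`, this makes `x ↦ x ⊓ e` a homomorphism onto the interval
below `e`, with complement taken relative to `e`. -/
lemma add_inf_idem (x y : A) : (x + y) ⊓ e = x ⊓ e + y ⊓ e := by
  rw [add_inf', inf_add', inf_add', he]
  refine le_antisymm (le_inf (le_inf inf_le_left ?_) (le_inf ?_ inf_le_right)) ?_
  · exact inf_le_right.trans (le_add_right' _ _)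
  · exact inf_le_right.trans (le_add_left' _ _)
  · exact inf_le_inf inf_le_left inf_le_right

lemma compl_inf_inf_idem (x : A) : (x ⊓ e)ᶜ ⊓ e = xᶜ ⊓ e := by
  rw [compl_inf', inf_sup_right, inf_comm eᶜ, inf_compl_of_idem he, sup_eq_left]
  exact zero_le' _

lemma inf_idem {f : A} (hf : f + f = f) : e ⊓ f + e ⊓ f = e ⊓ f := by
  rw [← add_inf_idem hf, he]

lemma eq_of_inf_idem {x y : A} (h : x ⊓ e = y ⊓ e) (h' : x ⊓ eᶜ = y ⊓ eᶜ) : x = y := by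
  rw [← inf_one' x, ← inf_one' y, ← sup_compl_of_idem he, inf_sup_left, inf_sup_left, h, h']

end Idempotent

end Arithmetic

/-! ### Bounded chains. -/

section Chain

variable {C : Type u} [MVAlgebra C] {n : ℕ} (hC : ∀ x : C, x ≠ 0 → n • x = 0ᶜ)
include hC

lemma le_total_of_nsmul (x y : C) : x ≤ y ∨ y ≤ x := by
  by_contra! h
  have h1 := inf_nsmul_eq_zero (tsub_inf_tsub x y) n
  rw [hC _ (fun h0 => h.2 (tsub_eq_zero.1 h0)), inf_one'] at h1
  exact h.1 (tsub_eq_zero.1 h1)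

/-- A smallest gap between consecutive elements of `s` serves as `d`, since the maximum lies `m`
gaps above the minimum. The induction removes the maximum and keeps the smaller of the old `d` and
the new gap. -/
lemma exists_nsmul_le [Nontrivial C] (m : ℕ) (s : Finset C) (hs : s.card = m + 1) :
    ∃ d ≠ (0 : C), ∃ y ∈ s, m • d ≤ y := by
  induction m generalizing s with
  | zero =>
    obtain ⟨d, hd⟩ := exists_ne (0 : C)
    obtain ⟨y, hy⟩ : s.Nonempty := Finset.card_pos.1 (by omega)
    exact ⟨d, hd, y, hy, by rw [zero_nsmul]; exact zero_le' y⟩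
  | succ m ih =>
    classical
    obtain ⟨y, hy, hmax⟩ := s.exists_maximal (Finset.card_pos.1 (by omega))
    obtain ⟨d, hd, z, hz, hle⟩ := ih (s.erase y) (by rw [Finset.card_erase_of_mem hy]; omega)
    have hzy : z ≤ y := (le_total_of_nsmul hC z y).elim id (hmax (Finset.mem_of_mem_erase hz))
    have hne : tsub y z ≠ 0 := fun h =>
      Finset.ne_of_mem_erase hz (le_antisymm hzy (tsub_eq_zero.1 h))
    have hy' : z + tsub y z = y := by rw [add_comm, tsub_add_of_le hzy]
    rcases le_total_of_nsmul hC d (tsub y z) with h | h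
    · exact ⟨d, hd, y, hy, by rw [succ_nsmul]; exact (add_mono hle h).trans hy'.le⟩
    · refine ⟨_, hne, y, hy, ?_⟩
      rw [succ_nsmul]
      exact (add_mono ((nsmul_mono h m).trans hle) le_rfl).trans hy'.le

lemma card_le_of_nsmul (s : Finset C) : s.card ≤ n + 1 := by
  classical
  by_contra! h
  obtain ⟨t, -, ht⟩ := Finset.exists_subset_card_eq (s := s) (n := n + 2) (by omega)
  have : Nontrivial C := by
    obtain ⟨a, -, b, -, hab⟩ := Finset.one_lt_card.1 (show 1 < t.card by omega)
    exact ⟨a, b, hab⟩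
  obtain ⟨y, hy, hmax⟩ := t.exists_maximal (Finset.card_pos.1 (by omega))
  obtain ⟨d, hd, z, hz, hle⟩ :=
    exists_nsmul_le hC n (t.erase y) (by rw [Finset.card_erase_of_mem hy]; omega)
  -- `n` gaps already reach `1`, so `z`, which lies strictly below the maximum `y`, would be the top
  -- element.
  rw [hC d hd] at hle
  have hyz : y ≤ z := (le_one y).trans hle
  exact Finset.ne_of_mem_erase hz (le_antisymm (hmax (Finset.mem_of_mem_erase hz) hyz) hyz)

lemma finite_of_nsmul : Finite C ∧ Nat.card C ≤ n + 1 := by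
  have hfin : Finite C := by
    by_contra h
    rw [not_finite_iff_infinite] at h
    obtain ⟨s, hs⟩ := Infinite.exists_subset_card_eq C (n + 2)
    have := card_le_of_nsmul hC s
    omega
  have := Fintype.ofFinite C
  exact ⟨hfin, by rw [Nat.card_eq_fintype_card]; exact card_le_of_nsmul hC Finset.univ⟩

end Chain

end MVAlgebra

end MV

/-! ### Ultrafilters of idempotents and their finite quotients. -/

namespace MV

namespace MVAlgebra

/-- Ultrafilters of the Boolean algebra of idempotents, with upward closure omitted. -/
structure IsUltra {A : Type u} [MVAlgebra A] (U : Set A) : Prop where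
  idem : ∀ e ∈ U, e + e = e
  top : 0ᶜ ∈ U
  bot : (0 : A) ∉ U
  inf : ∀ e ∈ U, ∀ f ∈ U, e ⊓ f ∈ U
  compl : ∀ e, e + e = e → e ∈ U ∨ eᶜ ∈ U

variable {A : Type u} [MVAlgebra A]

lemma exists_isUltra {c : A} (hc : c + c = c) (h0 : c ≠ 0) : ∃ U, IsUltra U ∧ c ∈ U := by
  -- The prime ideal is taken in the whole lattice; `U` consists of the idempotents outside it.
  obtain ⟨J, hJ, -, hdisj⟩ := DistribLattice.prime_ideal_of_disjoint_filter_ideal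
    (F := Order.PFilter.principal c) (I := Order.Ideal.principal (0 : A)) (by
      rw [Set.disjoint_left]
      intro x hx hx'
      exact h0 (le_zero_iff'.1 (le_trans hx hx')))
  have hcJ : c ∉ J := fun h => Set.disjoint_left.1 hdisj (show c ∈ Order.PFilter.principal c from
    le_refl c) h
  have htop : (0ᶜ : A) ∉ J := fun h => hcJ (J.lower (le_one c) h)
  refine ⟨{e | e + e = e ∧ e ∉ J}, ⟨fun e he => he.1, ⟨add_compl_zero _, htop⟩, fun h => h.2
    (J.nonempty.elim fun x hx => J.lower (zero_le' x) hx), fun e he f hf => ⟨inf_idem he.1 hf.1, fun h => ?_⟩, fun e he => ?_⟩, hc, hcJ⟩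
  · exact (hJ.mem_or_mem h).elim he.2 hf.2
  · by_contra! h
    have h1 : e ∈ J := by by_contra h'; exact h.1 ⟨he, h'⟩
    have h2 : eᶜ ∈ J := by by_contra h'; exact h.2 ⟨compl_idem he, h'⟩
    exact htop (sup_compl_of_idem he ▸ Order.Ideal.sup_mem h1 h2)

namespace IsUltra

variable {U : Set A} (hU : IsUltra U)

/-- The congruence "equal on a member of the ultrafilter". -/
def con : AddCon A where
  r x y := ∃ e ∈ U, x ⊓ e = y ⊓ e
  iseqv :=
    { refl := fun _ => ⟨_, hU.top, rfl⟩
      symm := fun ⟨e, he, h⟩ => ⟨e, he, h.symm⟩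
      trans := fun ⟨e, he, h⟩ ⟨f, hf, h'⟩ => ⟨e ⊓ f, hU.inf e he f hf, by
        rw [← inf_assoc, h, inf_right_comm, h', inf_right_comm, inf_assoc]⟩ }
  add' := fun ⟨e, he, h⟩ ⟨f, hf, h'⟩ => ⟨e ⊓ f, hU.inf e he f hf, by
    have hef := inf_idem (hU.idem e he) (hU.idem f hf)
    rw [add_inf_idem hef, add_inf_idem hef]
    congr 1
    · rw [← inf_assoc, h, inf_assoc]
    · rw [inf_comm e, ← inf_assoc, h', inf_assoc]⟩

lemma con_compl {x y : A} (h : hU.con x y) : hU.con xᶜ yᶜ := by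
  obtain ⟨e, he, h⟩ := h
  refine ⟨e, he, ?_⟩
  have hi := hU.idem e he
  rw [← compl_inf_inf_idem hi, h, compl_inf_inf_idem hi]

/-- The quotient by an ultrafilter. -/
abbrev Quot : Type u := hU.con.Quotient

instance : MVAlgebra hU.Quot where
  compl := Quotient.map (·ᶜ) fun _ _ h => hU.con_compl h
  compl_compl' := by
    rintro ⟨x⟩
    exact congrArg (fun y : A => (y : hU.con.Quotient)) (cc x)
  add_compl_zero := by
    rintro ⟨x⟩
    exact congrArg (fun y : A => (y : hU.con.Quotient)) (add_compl_zero x)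
  lukasiewicz := by
    rintro ⟨x⟩ ⟨y⟩
    exact congrArg (fun y : A => (y : hU.con.Quotient)) (lukasiewicz x y)

/-- The quotient map. -/
def proj (x : A) : hU.Quot := (x : hU.con.Quotient)

lemma proj_surjective : Function.Surjective hU.proj := Quotient.exists_rep

lemma proj_eq {x y : A} : hU.proj x = hU.proj y ↔ ∃ e ∈ U, x ⊓ e = y ⊓ e := AddCon.eq _

lemma proj_add (x y : A) : hU.proj (x + y) = hU.proj x + hU.proj y := rfl

lemma proj_compl (x : A) : hU.proj xᶜ = (hU.proj x)ᶜ := rfl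

lemma proj_zero : hU.proj 0 = 0 := rfl

lemma proj_nsmul (k : ℕ) (x : A) : hU.proj (k • x) = k • hU.proj x := rfl

lemma proj_eq_one {e : A} (he : e ∈ U) : hU.proj e = 0ᶜ := by
  rw [← proj_zero, ← proj_compl, proj_eq]
  exact ⟨e, he, by rw [_root_.inf_idem, inf_comm, inf_one']⟩

/-- The ultrafilter decides the idempotent `n • x`: either it becomes `1`, or it becomes `0` and
takes `x ≤ n • x` with it. -/
lemma quot_nsmul {n : ℕ} (hn : ∀ x : A, n • x = (n + 1) • x) (z : hU.Quot) (hz : z ≠ 0) :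
    n • z = 0ᶜ := by
  obtain ⟨x, rfl⟩ := hU.proj_surjective z
  have hi := nsmul_idem (hn x)
  rcases hU.compl _ hi with h | h
  · rw [← proj_nsmul, hU.proj_eq_one h]
  · exfalso
    apply hz
    rw [← proj_zero, proj_eq]
    refine ⟨_, h, ?_⟩
    rw [zero_inf', ← le_zero_iff', ← inf_compl_of_idem hi]
    refine inf_le_inf ?_ le_rfl
    rw [hn, succ_nsmul]
    exact le_add_left' _ _

/-- A tuple of MV-operations on `Fin k`. -/
abbrev Code (k : ℕ) : Type := (Fin k → Fin k → Fin k) × (Fin k → Fin k) × Fin k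

/-- The map `p` is a homomorphism onto the algebra with operations `o`, whose kernel is the
congruence of `U`. -/
structure IsCoded (U : Set A) {k : ℕ} (o : Code k) (p : A → Fin k) : Prop where
  surj : Function.Surjective p
  add : ∀ x y, p (x + y) = o.1 (p x) (p y)
  compl : ∀ x, p xᶜ = o.2.1 (p x)
  zero : p 0 = o.2.2
  eq_iff : ∀ x y, p x = p y ↔ ∃ e ∈ U, x ⊓ e = y ⊓ e

-- Transporting the quotient to `Fin k` leaves only finitely many possible codes, a number depending
-- on `n` alone.
include hU in
lemma exists_isCoded {n : ℕ} (hn : ∀ x : A, n • x = (n + 1) • x) :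
    ∃ k : Fin (n + 2), ∃ o : Code k, ∃ p, IsCoded U o p := by
  obtain ⟨hfin, hcard⟩ := finite_of_nsmul (hU.quot_nsmul hn)
  let φ := Finite.equivFin hU.Quot
  refine ⟨⟨Nat.card hU.Quot, by omega⟩, ⟨fun a b => φ (φ.symm a + φ.symm b),
    fun a => φ (φ.symm a)ᶜ, φ 0⟩, fun x => φ (hU.proj x), ?_⟩
  refine ⟨φ.surjective.comp hU.proj_surjective, fun x y => ?_, fun x => ?_, rfl, fun x y => ?_⟩
  · simp only [φ.symm_apply_apply, proj_add]
  · simp only [φ.symm_apply_apply, proj_compl]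
  · rw [φ.apply_eq_iff_eq, proj_eq]

end IsUltra

lemma exists_separating_ultra_of_not_le {n : ℕ} (hn : ∀ x : A, n • x = (n + 1) • x) {x y : A}
    (h : ¬ x ≤ y) : ∃ U, IsUltra U ∧ ∀ e ∈ U, x ⊓ e ≠ y ⊓ e := by
  have hle : tsub x y ≤ n • tsub x y := by rw [hn, succ_nsmul]; exact le_add_left' _ _
  have h0 : n • tsub x y ≠ 0 := fun h0 => h (tsub_eq_zero.1 (le_zero_iff'.1 (h0 ▸ hle)))
  -- If `x` and `y` agreed on a member of `U`, then `tsub x y`, and with it the member `n • tsub x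
  -- y`, would vanish on some member of `U`.
  obtain ⟨U, hU, hc⟩ := exists_isUltra (nsmul_idem (hn (tsub x y))) h0
  refine ⟨U, hU, fun e he hxy => ?_⟩
  have h1 : hU.proj x = hU.proj y := hU.proj_eq.2 ⟨e, he, hxy⟩
  have h2 : hU.proj (tsub x y) = hU.proj 0 := by
    change tsub (hU.proj x) (hU.proj y) = 0
    rw [h1, tsub_eq_zero]
  obtain ⟨f, hf, h3⟩ := hU.proj_eq.1 h2
  rw [zero_inf', inf_comm] at h3
  have h4 := inf_nsmul_eq_zero h3 n
  exact hU.bot (h4 ▸ hU.inf f hf _ hc)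

lemma exists_separating_ultra {n : ℕ} (hn : ∀ x : A, n • x = (n + 1) • x) {x y : A}
    (h : x ≠ y) : ∃ U, IsUltra U ∧ ∀ e ∈ U, x ⊓ e ≠ y ⊓ e := by
  by_cases hxy : x ≤ y
  · obtain ⟨U, hU, h'⟩ := exists_separating_ultra_of_not_le hn fun hyx => h (le_antisymm hxy hyx)
    exact ⟨U, hU, fun e he => (h' e he).symm⟩
  · exact exists_separating_ultra_of_not_le hn hxy

open IsUltra

lemma exists_separating_isCoded {n : ℕ} (hn : ∀ x : A, n • x = (n + 1) • x) {x y : A}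
    (h : x ≠ y) : ∃ U, IsUltra U ∧ ∃ (k : Fin (n + 2)) (o : Code k) (p : A → Fin k),
      IsCoded U o p ∧ p x ≠ p y := by
  obtain ⟨U, hU, h'⟩ := exists_separating_ultra hn h
  obtain ⟨k, o, p, hp⟩ := hU.exists_isCoded hn
  refine ⟨U, hU, k, o, p, hp, fun hxy => ?_⟩
  obtain ⟨e, he, hxy⟩ := (hp.eq_iff x y).1 hxy
  exact h' e he hxy

/-! ### Endomorphisms that overwrite one coordinate by another. -/

lemma IsUltra.exists_mem_compl_mem {U V : Set A} (hU : IsUltra U) (hV : IsUltra V) (h : U ≠ V) :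
    ∃ f ∈ U, fᶜ ∈ V := by
  by_cases hUV : U ⊆ V
  · obtain ⟨f, hf, hfU⟩ := Set.exists_of_ssubset (hUV.ssubset_of_ne h)
    exact ⟨fᶜ, (hU.compl f (hV.idem f hf)).resolve_left hfU, by rwa [cc]⟩
  · obtain ⟨f, hf, hfV⟩ := Set.not_subset.1 hUV
    exact ⟨f, hf, (hV.compl f (hU.idem f hf)).resolve_left hfV⟩

lemma IsUltra.exists_min [Finite A] {U : Set A} (hU : IsUltra U) :
    ∃ e ∈ U, ∀ f ∈ U, e ≤ f := by
  obtain ⟨e, he⟩ := (Set.toFinite U).exists_minimal ⟨_, hU.top⟩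
  exact ⟨e, he.prop, fun f hf =>
    (he.le_of_le (hU.inf e he.prop f hf) inf_le_left).trans inf_le_right⟩

/-- Copying the coordinate of `V` into the coordinate of `U`. -/
lemma IsUltra.exists_endomorphism {U V : Set A} (hU : IsUltra U) {e : A}
    (he : e ∈ U) (hmin : ∀ f ∈ U, e ≤ f) (hev : eᶜ ∈ V) {k : ℕ} {o : Code k} {p q : A → Fin k}
    (hp : IsCoded U o p) (hq : IsCoded V o q) :
    ∃ f : A → A, (∀ x y, f (x + y) = f x + f y) ∧ (∀ x, f xᶜ = (f x)ᶜ) ∧ f 0 = 0 ∧ f e = 0 ∧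
      ∀ x, f x ⊓ eᶜ = x ⊓ eᶜ := by
  have hi := hU.idem e he
  have hi' := compl_idem hi
  have hee : eᶜ ⊓ e = 0 := by rw [inf_comm]; exact inf_compl_of_idem hi
  let s := Function.surjInv hp.surj
  have hs : ∀ a, p (s a) = a := Function.surjInv_eq hp.surj
  -- The part below `eᶜ` is kept; the part below `e`, which is the coordinate of `U`, is replaced by
  -- a lift of the `V`-coordinate.
  let f : A → A := fun x => x ⊓ eᶜ + s (q x) ⊓ e
  have h1 : ∀ x, f x ⊓ eᶜ = x ⊓ eᶜ := fun x => by
    rw [add_inf_idem hi', inf_assoc, inf_assoc, _root_.inf_idem, inf_compl_of_idem hi, inf_zero',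
      add_zero]
  have h2 : ∀ x, p (f x) = q x := fun x => by
    rw [← hs (q x), hp.eq_iff]
    refine ⟨e, he, ?_⟩
    rw [add_inf_idem hi, inf_assoc, hee, inf_assoc, _root_.inf_idem, inf_zero', zero_add]
  -- Since `e` is least in `U`, the `U`-coordinate determines the part below `e`. Every identity for
  -- `f` can thus be checked in the two factors, and the common code `o` handles the first.
  have hext : ∀ x y, p x = p y → x ⊓ eᶜ = y ⊓ eᶜ → x = y := fun x y hxy h => by
    obtain ⟨g, hg, hxy⟩ := (hp.eq_iff x y).1 hxy
    refine eq_of_inf_idem hi ?_ h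
    rw [← inf_eq_right.2 (hmin g hg), ← inf_assoc, hxy, inf_assoc]
  refine ⟨f, fun x y => hext _ _ ?_ ?_, fun x => hext _ _ ?_ ?_, hext _ _ ?_ ?_, hext _ _ ?_ ?_, h1⟩
  · rw [h2, hq.add, hp.add, h2, h2]
  · rw [h1, add_inf_idem hi', add_inf_idem hi', h1, h1]
  · rw [h2, hq.compl, hp.compl, h2]
  · rw [h1, ← compl_inf_inf_idem hi' (f x), h1, compl_inf_inf_idem hi']
  · rw [h2, hq.zero, hp.zero]
  · rw [h1]
  · rw [h2, hp.zero, ← hq.zero, hq.eq_iff]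
    exact ⟨eᶜ, hev, by rw [inf_compl_of_idem hi, zero_inf']⟩
  · rw [h1, inf_compl_of_idem hi, zero_inf']

/-- A finite algebra with many elements has two endomorphisms that are not injective and jointly
separate points. -/
lemma exists_separating_endomorphisms {n : ℕ} (hn : ∀ x : A, n • x = (n + 1) • x) [Finite A]
    (hcard : (n + 2) ^ Nat.card (Σ k : Fin (n + 2), Code k) < Nat.card A) {x y : A} (hxy : x ≠ y) :
    ∃ f : A → A, (∀ x y, f (x + y) = f x + f y) ∧ (∀ x, f xᶜ = (f x)ᶜ) ∧ f 0 = 0 ∧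
      ¬ Function.Injective f ∧ f x ≠ f y := by
  choose k o p hp using fun U : {U : Set A // IsUltra U} => U.2.exists_isCoded hn
  let c : {U : Set A // IsUltra U} → Σ k : Fin (n + 2), Code k := fun U => ⟨k U, o U⟩
  obtain ⟨U, V, hcUV, hUV⟩ : ∃ U V, c U = c V ∧ U ≠ V := by
    by_contra! hinj
    refine hcard.not_ge ?_
    have h1 : Nat.card {U : Set A // IsUltra U} ≤ Nat.card (Σ k : Fin (n + 2), Code k) :=
      Nat.card_le_card_of_injective c hinj
    have h2 : Nat.card A ≤ Nat.card ({U : Set A // IsUltra U} → Fin (n + 2)) := by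
      refine Nat.card_le_card_of_injective (fun x U => (p U x).castLE (k U).2.le) fun x y h => ?_
      by_contra hne
      obtain ⟨U, hU, h'⟩ := exists_separating_ultra hn hne
      obtain ⟨e, he, h''⟩ := ((hp ⟨U, hU⟩).eq_iff x y).1 (Fin.castLE_injective _ (congrFun h ⟨U, hU⟩))
      exact h' e he h''
    refine h2.trans ?_
    rw [Nat.card_fun, Nat.card_fin]
    exact Nat.pow_le_pow_right (by omega) h1
  have hUV' : U.1 ≠ V.1 := fun h => hUV (Subtype.ext h)
  have hpU := hp U
  have hpV := hp V
  obtain ⟨k', o', p', q', hp', hq'⟩ : ∃ (k' : ℕ) (o' : Code k') (p' q' : A → Fin k'),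
      IsCoded U.1 o' p' ∧ IsCoded V.1 o' q' := by
    -- Generalizing over the code lets the coding of `V` be transported along the equality of
    -- dependent pairs.
    have h : ∀ d : Σ k : Fin (n + 2), Code k, c V = d → ∃ q', IsCoded V.1 d.2 q' := by
      rintro _ rfl
      exact ⟨_, hpV⟩
    obtain ⟨q', hq'⟩ := h (c U) hcUV.symm
    exact ⟨_, _, _, q', hpU, hq'⟩
  obtain ⟨e, he, hemin⟩ := U.2.exists_min
  obtain ⟨g, hg, hgmin⟩ := V.2.exists_min
  obtain ⟨a, haU, haV⟩ := U.2.exists_mem_compl_mem V.2 hUV'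
  -- Distinct ultrafilters have disjoint least elements.
  have heg : e ≤ gᶜ := (hemin a haU).trans (by rw [← compl_le_compl_iff', cc]; exact hgmin _ haV)
  have hge : g ≤ eᶜ := by rw [← compl_le_compl_iff', cc]; exact heg
  have upward : ∀ {W : Set A} {a b : A}, IsUltra W → a ∈ W → a ≤ b → b + b = b → b ∈ W := by
    intro W a b hW ha hab hb
    refine (hW.compl b hb).resolve_right fun h => hW.bot ?_
    have := hW.inf a ha _ h
    rwa [le_zero_iff'.1 ((inf_le_inf hab le_rfl).trans (inf_compl_of_idem hb).le)] at this
  have hie := U.2.idem e he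
  have hig := V.2.idem g hg
  obtain ⟨f₁, hadd₁, hcompl₁, hzero₁, he₁, hf₁⟩ := U.2.exists_endomorphism he hemin
    (upward V.2 hg hge (compl_idem hie)) hp' hq'
  obtain ⟨f₂, hadd₂, hcompl₂, hzero₂, hg₂, hf₂⟩ := V.2.exists_endomorphism hg hgmin
    (upward U.2 he heg (compl_idem hig)) hq' hp'
  have hninj₁ : ¬ Function.Injective f₁ := fun h => U.2.bot (h (he₁.trans hzero₁.symm) ▸ he)
  have hninj₂ : ¬ Function.Injective f₂ := fun h => V.2.bot (h (hg₂.trans hzero₂.symm) ▸ hg)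
  by_cases h₁ : f₁ x = f₁ y
  · refine ⟨f₂, hadd₂, hcompl₂, hzero₂, hninj₂, fun h₂ => hxy ?_⟩
    -- Points identified by both maps agree below `eᶜ` and below `gᶜ`, and the latter covers `e`.
    have h1 : x ⊓ eᶜ = y ⊓ eᶜ := by rw [← hf₁, h₁, hf₁]
    have h2 : x ⊓ gᶜ = y ⊓ gᶜ := by rw [← hf₂, h₂, hf₂]
    refine eq_of_inf_idem hie ?_ h1
    rw [← inf_eq_right.2 heg, ← inf_assoc, h2, inf_assoc]
  · exact ⟨f₁, hadd₁, hcompl₁, hzero₁, hninj₁, h₁⟩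

end MVAlgebra

end MV

/-! ### A criterion for finite axiomatizability of quasivarieties. -/

namespace UniversalAlgebra

variable {L : FirstOrder.Language.{v, w}}

lemma reducedProduct_funMap {I : Type u} (F : Filter I) (M : I → Bundled.{u} L.Structure) {n : ℕ}
    (f : L.Functions n) (x : Fin n → ∀ i, M i) :
    Structure.funMap (M := reducedProduct F M) f
        (fun k => (Quotient.mk (F.productSetoid fun i => (M i : Type u)) (x k))) =
      Quotient.mk (F.productSetoid fun i => (M i : Type u))
        (fun i => Structure.funMap f fun k => x k i) :=
  letI := reducedPrestructure (L := L) F fun i => (M i : Type u)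
  funMap_quotient_mk' (F.productSetoid fun i => (M i : Type u)) f x

/-- Projections of direct products. -/
def directProductProj [L.IsAlgebraic] {I : Type u} (M : I → Bundled.{u} L.Structure) (i : I) :
    reducedProduct ⊤ M →[L] M i where
  toFun := Quotient.lift (fun x => x i) fun x y (h : ∀ᶠ j in ⊤, x j = y j) =>
    Filter.eventually_top.1 h i
  map_fun' {n} f x := by
    obtain ⟨y, rfl⟩ : ∃ y : Fin n → ∀ i, M i,
        x = fun k => Quotient.mk (Filter.productSetoid ⊤ fun i => (M i : Type u)) (y k) :=
      ⟨fun k => (x k).out, funext fun k => ((x k).out_eq).symm⟩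
    rw [reducedProduct_funMap]
    rfl
  map_rel' {n} r := isEmptyElim r

/-- The maps `h i` need not be homomorphisms: each instance of compatibility is required only on a
set in `F`, which suffices in the reduced product. -/
lemma IsQuasivariety.mem_of_family [L.IsAlgebraic] {K : Set (Bundled.{u} L.Structure)}
    (hK : IsQuasivariety K) {B : Type u} [L.Structure B] {I : Type u} (F : Filter I)
    (M : I → Bundled.{u} L.Structure) (hM : ∀ i, M i ∈ K) (h : ∀ i, B → M i)
    (hmap : ∀ {n} (f : L.Functions n) (x : Fin n → B),
      ∀ᶠ i in F, h i (Structure.funMap f x) = Structure.funMap f fun k => h i (x k))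
    (hinj : ∀ a b, (∀ᶠ i in F, h i a = h i b) → a = b) :
    (⟨B, inferInstance⟩ : Bundled.{u} L.Structure) ∈ K := by
  let g : B →[L] reducedProduct F M :=
    { toFun := fun b => Quotient.mk (F.productSetoid fun i => (M i : Type u)) fun i => h i b
      map_fun' := fun f x => by
        refine Eq.trans ?_ (reducedProduct_funMap F M f fun k i => h i (x k)).symm
        exact Quotient.sound (hmap f x)
      map_rel' := fun r => isEmptyElim r }
  have hg : Function.Injective g := fun a b hab => hinj a b (Quotient.exact hab)
  exact hK.iso _ (hK.sub _ (hK.reduced I F M hM) _) _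
    ⟨(Language.Embedding.ofInjective hg).equivRange.symm⟩

lemma IsQuasivariety.mem_of_separating [L.IsAlgebraic] {K : Set (Bundled.{u} L.Structure)}
    (hK : IsQuasivariety K) {B : Type u} [L.Structure B]
    (h : ∀ a b : B, a ≠ b → ∃ C ∈ K, ∃ f : B →[L] C, f a ≠ f b) :
    (⟨B, inferInstance⟩ : Bundled.{u} L.Structure) ∈ K := by
  choose C hC f hf using fun p : {p : B × B // p.1 ≠ p.2} => h p.1.1 p.1.2 p.2
  refine hK.mem_of_family ⊤ C hC (fun p => f p)
    (fun g x => Filter.Eventually.of_forall fun p => (f p).map_fun g x) fun a b hab => ?_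
  by_contra hne
  exact hf ⟨(a, b), hne⟩ (Filter.eventually_top.1 hab ⟨(a, b), hne⟩)

/-- A quasivariety is closed under directed unions of finitely generated subalgebras. -/
lemma IsQuasivariety.mem_of_fg [L.IsAlgebraic] {K : Set (Bundled.{u} L.Structure)}
    (hK : IsQuasivariety K) {A : Type u} [L.Structure A]
    (h : ∀ S : L.Substructure A, S.FG → (⟨S, inferInstance⟩ : Bundled.{u} L.Structure) ∈ K) :
    (⟨A, inferInstance⟩ : Bundled.{u} L.Structure) ∈ K := by
  classical
  rcases isEmpty_or_nonempty A with hA | ⟨⟨a⟩⟩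
  · exact hK.iso _ (h ⊤ Substructure.FG.of_finite) _ ⟨Substructure.topEquiv⟩
  -- The base point `a` is put into every `S s` so that it can be the default value of `r s` outside
  -- `S s`.
  let S : Finset A → L.Substructure A := fun s => Substructure.closure L ((insert a s : Finset A) : Set A)
  have hmem : ∀ b, ∀ᶠ s in Filter.atTop, b ∈ S s := fun b => by
    filter_upwards [Filter.eventually_ge_atTop {b}] with s hs
    exact Substructure.subset_closure (Finset.mem_insert_of_mem (hs (Finset.mem_singleton_self b)))
  let r : ∀ s, A → S s := fun s b => if hb : b ∈ S s then ⟨b, hb⟩ else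
    ⟨a, Substructure.subset_closure (Finset.mem_insert_self a s)⟩
  have hr : ∀ s b, b ∈ S s → (r s b : A) = b := fun s b hb => by simp only [r, dif_pos hb]
  refine hK.mem_of_family Filter.atTop (fun s => ⟨S s, inferInstance⟩)
    (fun s => h _ (Substructure.fg_closure (Finset.finite_toSet _))) r (fun f x => ?_)
    fun b c hbc => ?_
  · filter_upwards [Filter.eventually_all.2 fun k => hmem (x k)] with s hs
    have hf := (S s).fun_mem f x hs
    apply Subtype.ext
    rw [hr s _ hf]
    change _ = Structure.funMap f fun k => (r s (x k) : A)
    exact congrArg _ (funext fun k => (hr s _ (hs k)).symm)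
  · obtain ⟨s, hbc, hb, hc⟩ := (hbc.and ((hmem b).and (hmem c))).exists
    rw [← hr s b hb, ← hr s c hc, hbc]

lemma Quasiequation.Holds.of_embedding {q : Quasiequation L} {A B : Type u} [L.Structure A]
    [L.Structure B] (hq : q.Holds B) (f : A ↪[L] B) : q.Holds A := fun x hx => by
  refine f.injective ?_
  rw [← HomClass.realize_term f, ← HomClass.realize_term f]
  refine hq _ fun e he => ?_
  rw [HomClass.realize_term f, HomClass.realize_term f, hx e he]

/-- A finite algebra outside a quasivariety is excluded by a valid quasiequation, namely its
diagram. -/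
lemma IsQuasivariety.exists_quasiequation [L.IsAlgebraic] [Finite (Σ n, L.Functions n)]
    {K : Set (Bundled.{u} L.Structure)} (hK : IsQuasivariety K) {B : Type u} [L.Structure B]
    [Finite B] (hB : (⟨B, inferInstance⟩ : Bundled.{u} L.Structure) ∉ K) :
    ∃ q : Quasiequation L, (∀ A ∈ K, q.Holds A) ∧ ¬ q.Holds B := by
  -- Some pair is identified by all homomorphisms into `K`. The premises will be the operation
  -- tables of `B`, so that satisfying assignments are homomorphisms, and the conclusion will
  -- identify this pair.
  obtain ⟨a, b, hab, hsep⟩ : ∃ a b : B, a ≠ b ∧ ∀ C ∈ K, ∀ f : B →[L] C, f a = f b := by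
    by_contra! h
    exact hB (hK.mem_of_separating h)
  obtain ⟨e, he⟩ := exists_injective_nat B
  have : Nonempty B := ⟨a⟩
  have := Fintype.ofFinite (Σ p : (Σ n, L.Functions n), (Fin p.1 → B))
  let premise : (Σ p : (Σ n, L.Functions n), (Fin p.1 → B)) → L.Term ℕ × L.Term ℕ := fun p =>
    (Term.func p.1.2 fun k => Term.var (e (p.2 k)), Term.var (e (Structure.funMap p.1.2 p.2)))
  refine ⟨⟨Finset.univ.toList.map premise, (Term.var (e a), Term.var (e b))⟩,
    fun C hC x hx => ?_, fun h => hab ?_⟩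
  · let f : B →[L] C :=
      { toFun := fun b => x (e b)
        map_fun' := fun {n} f y => (hx _ (List.mem_map.2
          ⟨⟨⟨n, f⟩, y⟩, Finset.mem_toList.2 (Finset.mem_univ _), rfl⟩)).symm
        map_rel' := fun r => isEmptyElim r }
    exact hsep C hC f
  · have hinv : ∀ b, Function.invFun e (e b) = b := Function.leftInverse_invFun he
    have := h (Function.invFun e) fun t ht => by
      obtain ⟨p, -, rfl⟩ := List.mem_map.1 ht
      simp only [premise, Term.realize, hinv]
    simpa only [Term.realize, hinv] using this

lemma finite_structure [L.IsAlgebraic] [Finite (Σ n, L.Functions n)] (M : Type u) [Finite M] :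
    Finite (L.Structure M) := by
  refine Finite.of_injective
    (fun S (p : Σ n, L.Functions n) => S.funMap (n := p.1) p.2) fun S T h => ?_
  refine Structure.ext ?_ ?_
  · funext n f
    exact congrFun h ⟨n, f⟩
  · funext n r
    exact isEmptyElim r

/-- A quasivariety is finitely axiomatizable if finitely many of its quasiequations define a
locally finite class in which only algebras of bounded size are critical relative to it. -/
theorem IsQuasivariety.isFinitelyAxiomatizable [L.IsAlgebraic] [Finite (Σ n, L.Functions n)]
    {K : Set (Bundled.{u} L.Structure)} (hK : IsQuasivariety K) (T : Set (Quasiequation L))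
    (hT : T.Finite) (hKT : ∀ A ∈ K, ∀ q ∈ T, q.Holds A)
    (hfin : ∀ (A : Type u) [L.Structure A], (∀ q ∈ T, q.Holds A) → Structure.FG L A → Finite A)
    (m : ℕ)
    (hcrit : ∀ (B : Type u) [L.Structure B] [Finite B], (∀ q ∈ T, q.Holds B) → m < Nat.card B →
      (∀ S : L.Substructure B, S ≠ ⊤ → (⟨S, inferInstance⟩ : Bundled.{u} L.Structure) ∈ K) →
      (⟨B, inferInstance⟩ : Bundled.{u} L.Structure) ∈ K) :
    IsFinitelyAxiomatizable K := by
  have := fun k => finite_structure (L := L) (Fin k)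
  -- Small algebras are listed on `Fin k`, where they are finite in number, and lifted to the
  -- universe of `K`.
  let lift : ∀ k, L.Structure (Fin k) → L.Structure (ULift.{u} (Fin k)) := fun k S =>
    letI := S
    Equiv.ulift.symm.inducedStructure
  have hex : ∀ p : Σ k : Fin (m + 1), L.Structure (Fin k), ∃ q : Quasiequation L,
      (∀ A ∈ K, q.Holds A) ∧ ((⟨_, lift _ p.2⟩ : Bundled.{u} L.Structure) ∉ K →
        ¬ @Quasiequation.Holds L q _ (lift _ p.2)) := fun p => by
    let := lift _ p.2
    by_cases hp : (⟨_, lift _ p.2⟩ : Bundled.{u} L.Structure) ∈ K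
    -- An algebra already in `K` needs no exclusion, so a trivial equation is used.
    · exact ⟨⟨[], (Term.var 0, Term.var 0)⟩, fun _ _ _ _ => rfl, fun h => absurd hp h⟩
    · obtain ⟨q, hq, hq'⟩ := hK.exists_quasiequation hp
      exact ⟨q, hq, fun _ => hq'⟩
  choose q hq hq' using hex
  refine ⟨T ∪ Set.range q, hT.union (Set.finite_range q), fun A => ⟨?_, fun hA => ?_⟩⟩
  · rintro hA _ (ht | ⟨p, rfl⟩)
    exacts [hKT A hA _ ht, hq p A hA]
  -- Finite models are handled by induction on size, which puts all proper subalgebras in `K`. A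
  -- large model then falls under `hcrit`, and a small one outside `K` would violate its own
  -- excluding quasiequation.
  have key : ∀ (k : ℕ) (B : Type u) [L.Structure B] [Finite B], Nat.card B = k →
      (∀ t ∈ T ∪ Set.range q, t.Holds B) → (⟨B, inferInstance⟩ : Bundled.{u} L.Structure) ∈ K := by
    intro k
    induction k using Nat.strong_induction_on with
    | _ k ih =>
    intro B _ _ hk hB
    have hsub : ∀ S : L.Substructure B, S ≠ ⊤ →
        (⟨S, inferInstance⟩ : Bundled.{u} L.Structure) ∈ K := fun S hS => by
      refine ih (Nat.card S) ?_ S rfl fun t ht => (hB t ht).of_embedding S.subtype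
      rw [← hk]
      obtain ⟨x, hx⟩ : ∃ x, x ∉ S := by
        by_contra! h
        exact hS (top_le_iff.1 fun x _ => h x)
      exact Finite.card_subtype_lt hx
    by_cases hm : m < Nat.card B
    · exact hcrit B (fun t ht => hB t (Or.inl ht)) hm hsub
    by_contra hBK
    let e : B ≃ Fin k := Finite.equivFinOfCardEq hk
    let S : L.Structure (Fin k) := e.inducedStructure
    let := lift k S
    have E : B ≃[L] ULift.{u} (Fin k) :=
      (Equiv.inducedStructureEquiv (L := L) Equiv.ulift.symm).comp e.inducedStructureEquiv
    refine hq' ⟨⟨k, by omega⟩, S⟩ (fun h => hBK (hK.iso _ h _ ⟨E.symm⟩)) ?_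
    exact (hB _ (Or.inr ⟨_, rfl⟩)).of_embedding E.symm.toEmbedding
  refine hK.mem_of_fg fun S hS => ?_
  have hSA : ∀ t ∈ T ∪ Set.range q, t.Holds S := fun t ht => (hA t ht).of_embedding S.subtype
  have : Finite S := hfin S (fun t ht => hSA t (Or.inl ht)) ((Substructure.fg_iff_structure_fg S).1 hS)
  exact key _ S rfl hSA

end UniversalAlgebra

/-! ### Application to MV-algebras. -/

namespace MV

open UniversalAlgebra MVAlgebra

instance : lang.IsAlgebraic := fun _ => inferInstanceAs (IsEmpty Empty)

instance : Finite (Σ n, lang.Functions n) := by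
  refine Finite.of_surjective
    (![⟨2, Func.oplus⟩, ⟨1, Func.neg⟩, ⟨0, Func.zero⟩] : Fin 3 → Σ n, lang.Functions n) ?_
  rintro ⟨_, f⟩
  cases f
  exacts [⟨0, rfl⟩, ⟨1, rfl⟩, ⟨2, rfl⟩]

lemma funMap_oplus {A : Type u} [lang.Structure A] (x : Fin 2 → A) :
    Structure.funMap (L := lang) Func.oplus x = oplus (x 0) (x 1) :=
  congrArg _ (List.ofFn_injective rfl)

lemma funMap_neg {A : Type u} [lang.Structure A] (x : Fin 1 → A) :
    Structure.funMap (L := lang) Func.neg x = neg (x 0) :=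
  congrArg _ (List.ofFn_injective rfl)

lemma funMap_zero {A : Type u} [lang.Structure A] (x : Fin 0 → A) :
    Structure.funMap (L := lang) Func.zero x = zero A :=
  congrArg _ (Subsingleton.elim _ _)

/-- Homomorphisms from maps that preserve the three operations. -/
def homOfMap {A : Type u} {B : Type v} [lang.Structure A] [lang.Structure B] (f : A → B)
    (h2 : ∀ x y, f (oplus x y) = oplus (f x) (f y)) (h1 : ∀ x, f (neg x) = neg (f x))
    (h0 : f (zero A) = zero B) : A →[lang] B where
  toFun := f
  map_fun' g x := by
    cases g
    · exact (congrArg f (funMap_oplus x)).trans ((h2 _ _).trans (funMap_oplus (f ∘ x)).symm)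
    · exact (congrArg f (funMap_neg x)).trans ((h1 _).trans (funMap_neg (f ∘ x)).symm)
    · exact (congrArg f (funMap_zero x)).trans (h0.trans (funMap_zero (f ∘ x)).symm)
  map_rel' r := isEmptyElim r

/-- An algebra of type `(2, 1, 0)` satisfying the MV-axioms as an `MVAlgebra`. -/
abbrev IsMVAlgebra.toMVAlgebra {A : Type u} [lang.Structure A] (h : IsMVAlgebra A) :
    MVAlgebra A where
  add := oplus
  zero := zero A
  add_assoc := h.assoc
  add_comm := h.comm
  add_zero := h.oplus_zero
  zero_add x := (h.comm _ _).trans (h.oplus_zero x)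
  nsmul := @nsmulRec A ⟨zero A⟩ ⟨oplus⟩
  nsmul_zero _ := rfl
  nsmul_succ _ _ := rfl
  compl := neg
  compl_compl' := h.neg_neg
  add_compl_zero := h.oplus_neg_zero
  lukasiewicz := h.lukasiewicz

/-- The algebra on `Fin k` with prescribed operations. -/
abbrev codeStructure {k : ℕ} (o : IsUltra.Code k) : lang.Structure (Fin k) where
  funMap f := match f with
    | Func.oplus => fun x => o.1 (x 0) (x 1)
    | Func.neg => fun x => o.2.1 (x 0)
    | Func.zero => fun _ => o.2.2
  RelMap r := isEmptyElim r

section Terms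

/-- The term `s ⊕ t`. -/
def oplusTerm (s t : lang.Term ℕ) : lang.Term ℕ := Term.func (L := lang) (l := 2) Func.oplus ![s, t]

/-- The term `¬s`. -/
def negTerm (s : lang.Term ℕ) : lang.Term ℕ := Term.func (L := lang) (l := 1) Func.neg ![s]

/-- The term `0`. -/
def zeroTerm : lang.Term ℕ := Term.func (L := lang) (l := 0) Func.zero ![]

/-- The term `x ⊕ ⋯ ⊕ x` with `k` summands. -/
def multipleTerm : ℕ → lang.Term ℕ
  | 0 => zeroTerm
  | k + 1 => oplusTerm (multipleTerm k) (Term.var 0)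

variable {A : Type u} [lang.Structure A] (x : ℕ → A)

@[simp]
lemma realize_oplusTerm (s t : lang.Term ℕ) :
    (oplusTerm s t).realize x = oplus (s.realize x) (t.realize x) :=
  funMap_oplus fun i => (![s, t] i).realize x

@[simp]
lemma realize_negTerm (s : lang.Term ℕ) : (negTerm s).realize x = neg (s.realize x) :=
  funMap_neg fun i => (![s] i).realize x

@[simp]
lemma realize_zeroTerm : zeroTerm.realize x = zero A :=
  funMap_zero fun i => (![] i : lang.Term ℕ).realize x

lemma realize_multipleTerm (h : IsMVAlgebra A) (k : ℕ) :
    letI := h.toMVAlgebra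
    (multipleTerm k).realize x = k • x 0 := by
  let := h.toMVAlgebra
  change _ = k • x 0
  induction k with
  | zero => rw [zero_nsmul]; exact realize_zeroTerm x
  | succ k ih =>
    rw [succ_nsmul, ← ih]
    exact realize_oplusTerm x _ _

/-- The MV-axioms together with `n x ≈ (n + 1) x`. -/
def baseTheory (n : ℕ) : Set (Quasiequation lang) :=
  let x : lang.Term ℕ := Term.var 0
  let y : lang.Term ℕ := Term.var 1
  let z : lang.Term ℕ := Term.var 2
  {⟨[], (oplusTerm (oplusTerm x y) z, oplusTerm x (oplusTerm y z))⟩,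
    ⟨[], (oplusTerm x y, oplusTerm y x)⟩,
    ⟨[], (oplusTerm x zeroTerm, x)⟩,
    ⟨[], (negTerm (negTerm x), x)⟩,
    ⟨[], (oplusTerm x (negTerm zeroTerm), negTerm zeroTerm)⟩,
    ⟨[], (oplusTerm (negTerm (oplusTerm (negTerm x) y)) y,
      oplusTerm (negTerm (oplusTerm x (negTerm y))) x)⟩,
    ⟨[], (multipleTerm n, multipleTerm (n + 1))⟩}

lemma finite_baseTheory (n : ℕ) : (baseTheory n).Finite := by
  unfold baseTheory
  exact Set.toFinite _

lemma forall_baseTheory_holds_iff (n : ℕ) : (∀ q ∈ baseTheory n, q.Holds A) ↔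
    ∃ h : IsMVAlgebra A, letI := h.toMVAlgebra; ∀ x : A, n • x = (n + 1) • x := by
  simp only [baseTheory, Set.mem_insert_iff, Set.mem_singleton_iff, forall_eq_or_imp, forall_eq,
    Quasiequation.Holds, List.not_mem_nil, false_imp_iff, implies_true, true_imp_iff,
    realize_oplusTerm, realize_negTerm, realize_zeroTerm, Term.realize_var]
  constructor
  · rintro ⟨h1, h2, h3, h4, h5, h6, h7⟩
    have h : IsMVAlgebra A :=
      ⟨fun x y z => h1 (fun i => if i = 0 then x else if i = 1 then y else z),
        fun x y => h2 (fun i => if i = 0 then x else y), fun x => h3 fun _ => x,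
        fun x => h4 fun _ => x, fun x => h5 fun _ => x,
        fun x y => h6 (fun i => if i = 0 then x else y)⟩
    refine ⟨h, fun x => ?_⟩
    have := h7 fun _ => x
    rwa [realize_multipleTerm _ h, realize_multipleTerm _ h] at this
  · rintro ⟨h, hn⟩
    refine ⟨fun x => h.assoc _ _ _, fun x => h.comm _ _, fun x => h.oplus_zero _,
      fun x => h.neg_neg _, fun x => h.oplus_neg_zero _, fun x => h.lukasiewicz _ _, fun x => ?_⟩
    rw [realize_multipleTerm _ h, realize_multipleTerm _ h]
    exact hn _

end Terms

/-- In a locally finite quasivariety of MV-algebras some equation `n x ≈ (n + 1) x` is valid. -/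
lemma exists_nsmul_eq {K : Set (Bundled.{u} lang.Structure)} (hK : IsQuasivariety K)
    (hMV : ∀ A ∈ K, IsMVAlgebra A) (hfin : IsLocallyFinite K) :
    ∃ n : ℕ, ∀ A ∈ K, ∀ x : ℕ → A,
      (multipleTerm n).realize x = (multipleTerm (n + 1)).realize x := by
  by_contra! h
  choose A hA x hx using h
  let M : ULift.{u} ℕ → Bundled.{u} lang.Structure := fun i => A i.down
  have hP : reducedProduct ⊤ M ∈ K := hK.reduced _ ⊤ M fun i => hA i.down
  -- The coordinate at `i` violates the `i`-th equation, so no two consecutive multiples of `b` can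
  -- agree.
  let a : ∀ i : ULift.{u} ℕ, M i := fun i => x i.down 0
  let b : reducedProduct ⊤ M := Quotient.mk (Filter.productSetoid ⊤ fun i => (M i : Type u)) a
  have hb : ∀ i : ULift.{u} ℕ, ∀ k, directProductProj M i ((multipleTerm k).realize fun _ => b) =
      (multipleTerm k).realize (x i.down) := fun i k => by
    have hi := hMV _ (hA i.down)
    rw [← HomClass.realize_term (directProductProj M i), realize_multipleTerm _ hi,
      realize_multipleTerm _ hi]
    rfl
  have hmv := hMV _ hP
  let := hmv.toMVAlgebra
  obtain ⟨k, hk⟩ := exists_nsmul_stable (a := b)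
    (s := (Substructure.closure lang {b} : lang.Substructure (reducedProduct ⊤ M)))
    (Set.finite_coe_iff.1 (hfin _ hP _ (Substructure.fg_closure_singleton b))) fun k => by
      rw [← realize_multipleTerm (fun _ => b) hmv]
      exact Term.realize_mem _ _ fun _ => Substructure.subset_closure rfl
  rw [← realize_multipleTerm (fun _ => b) hmv, ← realize_multipleTerm (fun _ => b) hmv] at hk
  refine hx k ?_
  rw [← hb ⟨k⟩, ← hb ⟨k⟩, hk]

lemma finite_of_fg {A : Type u} [lang.Structure A] (h : IsMVAlgebra A) {n : ℕ}
    (hn : letI := h.toMVAlgebra; ∀ x : A, n • x = (n + 1) • x) (hfg : Structure.FG lang A) :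
    Finite A := by
  let := h.toMVAlgebra
  obtain ⟨s, hs, htop⟩ := Structure.fg_iff.1 hfg
  have := hs.to_subtype
  let H : (Σ k : Fin (n + 2), IsUltra.Code k) → Type u := fun c =>
    letI := codeStructure c.2
    A →[lang] Fin c.1
  have hH : ∀ c, Finite (H c) := fun c => by
    let := codeStructure c.2
    -- A homomorphism is determined by its values on the finite generating set `s`.
    refine Finite.of_injective (fun (f : A →[lang] Fin c.1) (a : s) => f a) fun f g hfg => ?_
    exact Language.Hom.eq_of_eqOn_dense htop fun a ha => congrFun hfg ⟨a, ha⟩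
  refine Finite.of_injective (β := (p : Σ c, H c) → Fin p.1.1) (fun a p =>
    letI := codeStructure p.1.2
    (p.2 : A →[lang] Fin p.1.1) a) fun a b hab => ?_
  by_contra hne
  obtain ⟨U, hU, k, o, p, hp, hpab⟩ := exists_separating_isCoded hn hne
  let := codeStructure o
  exact hpab (congrFun hab ⟨⟨k, o⟩, homOfMap p hp.add hp.compl hp.zero⟩)

lemma mem_of_card_lt {K : Set (Bundled.{u} lang.Structure)} (hK : IsQuasivariety K)
    {B : Type u} [lang.Structure B] [Finite B] (h : IsMVAlgebra B) {n : ℕ}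
    (hn : letI := h.toMVAlgebra; ∀ x : B, n • x = (n + 1) • x)
    (hcard : (n + 2) ^ Nat.card (Σ k : Fin (n + 2), IsUltra.Code k) < Nat.card B)
    (hsub : ∀ S : lang.Substructure B, S ≠ ⊤ →
      (⟨S, inferInstance⟩ : Bundled.{u} lang.Structure) ∈ K) :
    (⟨B, inferInstance⟩ : Bundled.{u} lang.Structure) ∈ K := by
  let := h.toMVAlgebra
  refine hK.mem_of_separating fun a b hab => ?_
  obtain ⟨f, hadd, hcompl, hzero, hninj, hf⟩ := exists_separating_endomorphisms hn hcard hab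
  let g : B →[lang] B := homOfMap f hadd hcompl hzero
  -- On a finite algebra a non-injective endomorphism is not surjective, so its range is a proper
  -- subalgebra and lies in `K`.
  refine ⟨_, hsub g.range fun htop => hninj ?_, g.codRestrict g.range fun x => ⟨x, rfl⟩, fun hg => hf ?_⟩
  · exact Finite.injective_iff_surjective.2 (Language.Hom.range_eq_top.1 htop)
  · exact congrArg Subtype.val hg

end MV

theorem theorem2p10 (K : Set (Bundled.{u} MV.lang.Structure))
    (hK : UniversalAlgebra.IsQuasivariety K)
    (hMV : ∀ A ∈ K, MV.IsMVAlgebra A)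
    (hfin : UniversalAlgebra.IsLocallyFinite K) :
    UniversalAlgebra.IsFinitelyAxiomatizable K := by
  obtain ⟨n, hn⟩ := MV.exists_nsmul_eq hK hMV hfin
  refine hK.isFinitelyAxiomatizable (MV.baseTheory n) (MV.finite_baseTheory n) (fun A hA => ?_)
    (fun A _ hA hfg => ?_)
    ((n + 2) ^ Nat.card (Σ k : Fin (n + 2), MV.MVAlgebra.IsUltra.Code k)) fun B _ _ hB hcard hsub => ?_
  · refine (MV.forall_baseTheory_holds_iff n).2 ⟨hMV A hA, fun x => ?_⟩
    have := hn A hA fun _ => x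
    rwa [MV.realize_multipleTerm _ (hMV A hA), MV.realize_multipleTerm _ (hMV A hA)] at this
  · obtain ⟨h, hn⟩ := (MV.forall_baseTheory_holds_iff n).1 hA
    exact MV.finite_of_fg h hn hfg
  · obtain ⟨h, hn⟩ := (MV.forall_baseTheory_holds_iff n).1 hB
    exact MV.mem_of_card_lt hK h hn hcard hsub
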